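/- **Carlson's theorem, classical version.** Let $C$ be a semigroup generated by some finite set $A\subseteq C$, let $x$ be a variable, and let $C[x]$ be the free product of the semigroup $C$ with the free semigroup generated by $x$ (its elements are nonempty words in $x$ and elements of $C$, where contiguous elements of $C$ are identified with their product); $C$ is regarded as a subsemigroup of $C[x]$. For $w(x)\in C[x]$ and $a\in A$ let $w(a)\in C$ be the result of replacing $x$ by $a$ in $w(x)$, and let $\Sigma$ be the set of the maps $C[x]\to C[x]$, $w(x)\mapsto w(a)$, for $a\in A$. For a sequence $\bar b=(b_i)_{i<\omega}$ in $C[x]$ and $I\subseteq\omega$ write $$\mathrm{fp}^{\Sigma}\,b_{\restriction I}=\big\{\sigma_0(b_{i_0})\cdots\sigma_k(b_{i_k}) : k<\omega,\ i_0<\dots<i_k \text{ in } I,\ \sigma_0,\dots,\sigma_k\in\Sigma\cup\{\mathrm{id}\}\big\},$$ and $\mathrm{fp}^{\Sigma}\,\bar b=\mathrm{fp}^{\Sigma}\,b_{\restriction\omega}$. Let $\bar s=(s_i)_{i<\omega}$ be a sequence of elements of $C[x]\smallsetminus C$. Then, for every finite colouring of $C[x]$, there are a strictly increasing sequence of positive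 integers $(n_i)_{i<\omega}$ and elements $a_i\in \mathrm{fp}^{\Sigma}\,s_{\restriction[n_i,n_{i+1})}\smallsetminus C$, for $i<\omega$, such that $\mathrm{fp}^{\Sigma}\,\bar a\smallsetminus C$ is monochromatic. (That is, $\bar a$ is an extracted variable sequence of $\bar s$.) -/

import Mathlib

/-- The relations that identify, in words over `M ⊕ N`, two contiguous letters of the same
semigroup with their product. -/
inductive FreeProductRel (M N : Type*) [Mul M] [Mul N] :
    FreeSemigroup (M ⊕ N) → FreeSemigroup (M ⊕ N) → Prop
  | left (a b : M) : FreeProductRel M N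
      (FreeSemigroup.of (Sum.inl a) * FreeSemigroup.of (Sum.inl b))
      (FreeSemigroup.of (Sum.inl (a * b)))
  | right (a b : N) : FreeProductRel M N
      (FreeSemigroup.of (Sum.inr a) * FreeSemigroup.of (Sum.inr b))
      (FreeSemigroup.of (Sum.inr (a * b)))

/-- The free product of two semigroups, i.e. their coproduct in the category of semigroups:
nonempty words over `M ⊕ N`, where two contiguous letters of the same semigroup are
identified with their product. (No units are involved: a unit of `M` or `N`, if there is any, is
not a unit of the free product.) -/
def SemigroupFreeProduct (M N : Type*) [Mul M] [Mul N] : Type _ :=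
  (conGen (FreeProductRel M N)).Quotient

namespace SemigroupFreeProduct

instance instSemigroup (M N : Type*) [Mul M] [Mul N] : Semigroup (SemigroupFreeProduct M N) :=
  inferInstanceAs (Semigroup (conGen (FreeProductRel M N)).Quotient)

/-- The projection from words over `M ⊕ N`. -/
def mk {M N : Type*} [Mul M] [Mul N] : FreeSemigroup (M ⊕ N) →ₙ* SemigroupFreeProduct M N :=
  (conGen (FreeProductRel M N)).mkMulHom

theorem mk_surjective {M N : Type*} [Mul M] [Mul N] :
    Function.Surjective (mk : FreeSemigroup (M ⊕ N) → SemigroupFreeProduct M N) :=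
  Quot.mk_surjective

theorem mk_eq_of_rel {M N : Type*} [Mul M] [Mul N] {u v : FreeSemigroup (M ⊕ N)}
    (h : FreeProductRel M N u v) : mk u = mk v :=
  (Con.eq (conGen (FreeProductRel M N))).2 (ConGen.Rel.of _ _ h)

/-- The canonical homomorphism of the first factor. -/
def inl {M N : Type*} [Mul M] [Mul N] : M →ₙ* SemigroupFreeProduct M N where
  toFun a := mk (FreeSemigroup.of (Sum.inl a))
  map_mul' a b := by rw [← map_mul]; exact (mk_eq_of_rel (.left a b)).symm

/-- The canonical homomorphism of the second factor. -/
def inr {M N : Type*} [Mul M] [Mul N] : N →ₙ* SemigroupFreeProduct M N where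
  toFun a := mk (FreeSemigroup.of (Sum.inr a))
  map_mul' a b := by rw [← map_mul]; exact (mk_eq_of_rel (.right a b)).symm

theorem rel_le_ker {M N P : Type*} [Mul M] [Mul N] [Semigroup P] (f : M →ₙ* P) (g : N →ₙ* P) :
    conGen (FreeProductRel M N) ≤ Con.ker (FreeSemigroup.lift (Sum.elim f g)) := by
  refine Con.conGen_le.2 fun u v h => ?_
  change FreeSemigroup.lift (Sum.elim f g) u = FreeSemigroup.lift (Sum.elim f g) v
  cases h <;> simp

/-- The homomorphism induced by a pair of homomorphisms of the factors. -/
def lift {M N P : Type*} [Mul M] [Mul N] [Semigroup P] (f : M →ₙ* P) (g : N →ₙ* P) :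
    SemigroupFreeProduct M N →ₙ* P where
  toFun w := Con.liftOn w (FreeSemigroup.lift (Sum.elim f g)) fun _ _ h => rel_le_ker f g h
  map_mul' u v := by
    obtain ⟨u, rfl⟩ := mk_surjective u
    obtain ⟨v, rfl⟩ := mk_surjective v
    exact map_mul (FreeSemigroup.lift (Sum.elim f g)) u v

@[simp]
theorem lift_inl {M N P : Type*} [Mul M] [Mul N] [Semigroup P] (f : M →ₙ* P) (g : N →ₙ* P)
    (a : M) : lift f g (inl a) = f a :=
  FreeSemigroup.lift_of (Sum.elim f g) (Sum.inl a)

@[simp]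
theorem lift_inr {M N P : Type*} [Mul M] [Mul N] [Semigroup P] (f : M →ₙ* P) (g : N →ₙ* P)
    (b : N) : lift f g (inr b) = g b :=
  FreeSemigroup.lift_of (Sum.elim f g) (Sum.inr b)

end SemigroupFreeProduct

/-- `C[x]`: the free product of `C` and the free semigroup on one generator, the variable. -/
abbrev WordsOver (C : Type*) [Semigroup C] : Type _ :=
  SemigroupFreeProduct C (FreeSemigroup Unit)

namespace WordsOver

/-- The inclusion of `C` in `C[x]`. -/
def const (C : Type*) [Semigroup C] : C →ₙ* WordsOver C :=
  SemigroupFreeProduct.inl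

/-- The constant words: `C` as a subset of `C[x]`. -/
def constants (C : Type*) [Semigroup C] : Set (WordsOver C) :=
  Set.range (const C)

/-- The value `w(a)` in `C` of a word `w(x)` of `C[x]`: the variable is replaced by `a`. -/
def eval {C : Type*} [Semigroup C] (a : C) : WordsOver C →ₙ* C :=
  SemigroupFreeProduct.lift (MulHom.id C) (FreeSemigroup.lift fun _ => a)

/-- The map `w(x) ↦ w(a)` as an endomorphism of `C[x]`. -/
def subst {C : Type*} [Semigroup C] (a : C) : WordsOver C →ₙ* WordsOver C :=
  (const C).comp (eval a)

end WordsOver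

/-- The product `f 0 * f 1 * ⋯ * f k` in a semigroup. -/
def semigroupProd {G : Type*} [Mul G] : (k : ℕ) → (Fin (k + 1) → G) → G
  | 0, f => f 0
  | k + 1, f => f 0 * semigroupProd k fun j => f j.succ

/-- The set `fp^S` of the restriction of the sequence `s` to the set of indices `I`: all products
`σ₀ s_{i₀} ⋯ σₖ s_{iₖ}` with `i₀ < ⋯ < iₖ` in `I` and each `σⱼ` in `S` or the identity. -/
def finiteProducts {G : Type*} [Mul G] (S : Set (G →ₙ* G)) (s : ℕ → G) (I : Set ℕ) : Set G :=
  {g | ∃ (k : ℕ) (i : Fin (k + 1) → ℕ) (σ : Fin (k + 1) → (G →ₙ* G)),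
    StrictMono i ∧ (∀ j, i j ∈ I) ∧ (∀ j, σ j ∈ S ∪ {MulHom.id G}) ∧
    g = semigroupProd k fun j => σ j (s (i j))}

/-!
The proof works in the compact right topological semigroup of ultrafilters on `G = C[x]`, with
`p * q` the product for which `E ∈ p * q` iff `{a | {b | a * b ∈ E} ∈ q} ∈ p`. Write `D` for the set
of nonconstant words. It is an ideal of `G` whose complement is a subsemigroup, and the
substitutions map `G` to the complement of `D` and fix that complement pointwise; nothing else about
`C[x]` is used, so most of the argument is about an abstract semigroup with such data.

The ultrafilters that contain `fp^Σ` of every tail of `s` form a closed subsemigroup `T`, stable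
under the substitutions. Suppose that `A` is nonempty (otherwise any idempotent `u ∈ T` with `D ∈ u`
will do, with `v = u`), and let `v` be an idempotent of `T` containing `Dᶜ`, minimal among such
idempotents (`exists_minimal_idempotent`). As the ultrafilters of `T` that contain `D` are an ideal
of `T`, there is an idempotent `u ∈ T` with `D ∈ u` and `u * v = v * u = u`
(`exists_idempotent_le`). For a substitution `σ`, the image `σ u` is an idempotent of `T` containing
`Dᶜ`, and it lies below `σ v = v`; by minimality `σ u = v`.

Thus in a product of factors `u` and `σ u`, all factors `σ u` equal `v`, and the product is `u` as
soon as one factor is `u`. Let `B ∈ u` be a colour class. The terms `a i` are chosen one after the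
other (`exists_next_term`), along with decreasing sets `P i ∈ u` and `Q i ∈ v`, where `P 0 = B`, in
such a way that the nonconstant products of the terms from the `i`-th on stay in `P i` and the
constant ones in `Q i`.
-/

open Filter

attribute [local instance] Ultrafilter.mul Ultrafilter.semigroup

/-! ### Idempotents in compact right topological semigroups -/

/-- Idempotents are ordered by `w ≤ v` iff `w * v = w` and `v * w = w`; a nonempty compact
subsemigroup has a minimal one, namely any idempotent of a minimal closed left ideal. -/
theorem exists_minimal_idempotent {M : Type*} [Semigroup M] [TopologicalSpace M] [T2Space M]
    (hcont : ∀ r : M, Continuous (· * r)) {N : Set M} (hne : N.Nonempty) (hN : IsCompact N)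
    (hmul : ∀ x ∈ N, ∀ y ∈ N, x * y ∈ N) :
    ∃ v ∈ N, v * v = v ∧ ∀ w ∈ N, w * w = w → w * v = w → v * w = w → w = v := by
  let 𝓛 : Set (Set M) :=
    {L | L ⊆ N ∧ IsClosed L ∧ L.Nonempty ∧ ∀ x ∈ N, ∀ y ∈ L, x * y ∈ L}
  have hN𝓛 : N ∈ 𝓛 := ⟨subset_rfl, hN.isClosed, hne, hmul⟩
  obtain ⟨L, -, hL⟩ : ∃ L, L ⊆ N ∧ Minimal (· ∈ 𝓛) L := by
    refine zorn_superset_nonempty 𝓛 (fun c hc hchain hcne => ?_) N hN𝓛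
    refine ⟨⋂₀ c, ⟨?_, isClosed_sInter fun t ht => (hc ht).2.1, ?_, ?_⟩,
      fun t ht => Set.sInter_subset_of_mem ht⟩
    · obtain ⟨t, ht⟩ := hcne
      exact (Set.sInter_subset_of_mem ht).trans (hc ht).1
    · exact IsCompact.nonempty_sInter_of_directed_nonempty_isCompact_isClosed (S := c)
        (hS := hcne.to_subtype) (IsChain.directedOn hchain.symm) (fun t ht => (hc ht).2.2.1)
        (fun t ht => hN.of_isClosed_subset (hc ht).2.1 (hc ht).1) (fun t ht => (hc ht).2.1)
    · exact fun x hx y hy t ht => (hc ht).2.2.2 x hx y (hy t ht)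
  obtain ⟨hLN, hLcl, hLne, hLmul⟩ := hL.prop
  obtain ⟨v, hvL, hv⟩ := exists_idempotent_in_compact_subsemigroup hcont L hLne
    (hN.of_isClosed_subset hLcl hLN) fun x hx y hy => hLmul x (hLN hx) y hy
  refine ⟨v, hLN hvL, hv, fun w hw hww hwv hvw => ?_⟩
  have hwL : w ∈ L := hwv ▸ hLmul w hw v hvL
  -- The closed left ideal `N * w` is contained in `L`, hence equals `L`.
  have hNw : (· * w) '' N ∈ 𝓛 := by
    refine ⟨?_, (hN.image (hcont w)).isClosed, hne.image _, ?_⟩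
    · rintro _ ⟨x, hx, rfl⟩
      exact hmul x hx w hw
    · rintro x hx _ ⟨y, hy, rfl⟩
      exact ⟨x * y, hmul x hx y hy, mul_assoc _ _ _⟩
  have hsub : (· * w) '' N ⊆ L := by
    rintro _ ⟨x, hx, rfl⟩
    exact hLmul x hx w hwL
  obtain ⟨t, -, ht⟩ : v ∈ (· * w) '' N := hL.le_of_le hNw hsub hvL
  change t * w = v at ht
  calc w = v * w := hvw.symm
    _ = t * (w * w) := by rw [← ht, mul_assoc]
    _ = v := by rw [hww, ht]

/-- Below an idempotent `v` there is an idempotent in each compact subsemigroup `K` that is stable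
under multiplication by `v` on either side: it is `v * e` for an idempotent `e` of `K * v`. -/
theorem exists_idempotent_le {M : Type*} [Semigroup M] [TopologicalSpace M] [T2Space M]
    (hcont : ∀ r : M, Continuous (· * r)) {K : Set M} (hne : K.Nonempty) (hK : IsCompact K)
    (hmul : ∀ x ∈ K, ∀ y ∈ K, x * y ∈ K) {v : M} (hv : v * v = v)
    (hleft : ∀ x ∈ K, v * x ∈ K) (hright : ∀ x ∈ K, x * v ∈ K) :
    ∃ u ∈ K, u * u = u ∧ u * v = u ∧ v * u = u := by
  obtain ⟨e, ⟨x, hx, rfl⟩, he⟩ := exists_idempotent_in_compact_subsemigroup hcont ((· * v) '' K)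
    (hne.image _) (hK.image (hcont v)) (by
      rintro _ ⟨x, hx, rfl⟩ _ ⟨y, hy, rfl⟩
      exact ⟨x * v * y, hmul _ (hright x hx) y hy, mul_assoc _ _ _⟩)
  change x * v * (x * v) = x * v at he
  have hev : x * v * v = x * v := by rw [mul_assoc, hv]
  refine ⟨v * (x * v), hleft _ (hright x hx), ?_, by rw [mul_assoc, hev], by rw [← mul_assoc, hv]⟩
  calc v * (x * v) * (v * (x * v)) = v * (x * v * v * (x * v)) := by simp only [mul_assoc]
    _ = v * (x * v) := by rw [hev, he]

/-! ### Products of finitely many terms -/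

theorem mem_finiteProducts_singleton {G : Type*} [Mul G] {S : Set (G →ₙ* G)} {s : ℕ → G}
    {I : Set ℕ} {i : ℕ} (hi : i ∈ I) {σ : G →ₙ* G} (hσ : σ ∈ S ∪ {MulHom.id G}) :
    σ (s i) ∈ finiteProducts S s I :=
  ⟨0, fun _ => i, fun _ => σ, Subsingleton.strictMono (α := Fin 1) _, fun _ => hi, fun _ => hσ, rfl⟩

theorem mul_mem_finiteProducts_cons {G : Type*} [Mul G] {S : Set (G →ₙ* G)} {s : ℕ → G}
    {I : Set ℕ} {i : ℕ} (hi : i ∈ I) {σ : G →ₙ* G} (hσ : σ ∈ S ∪ {MulHom.id G}) {w : G}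
    (hw : w ∈ finiteProducts S s (I ∩ Set.Ioi i)) :
    σ (s i) * w ∈ finiteProducts S s I := by
  obtain ⟨k, j, τ, hj, hjI, hτ, rfl⟩ := hw
  refine ⟨k + 1, Fin.cons i j, Fin.cons σ τ, ?_, ?_, ?_, ?_⟩
  · rw [Fin.strictMono_iff_lt_succ]
    intro l
    refine Fin.cases ?_ (fun m => ?_) l
    · simpa using (hjI 0).2
    · rw [Fin.cons_succ, ← Fin.succ_castSucc, Fin.cons_succ]
      exact hj m.castSucc_lt_succ
  · exact Fin.cases hi fun m => by simpa using (hjI m).1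
  · exact Fin.cases hσ fun m => by simpa using hτ m
  · simp [semigroupProd]

/-- Induction on the number of factors of a product, the first factor being split off. -/
theorem finiteProducts_induction {G : Type*} [Mul G] {S : Set (G →ₙ* G)} {s : ℕ → G}
    {p : Set ℕ → G → Prop}
    (single : ∀ I, ∀ i ∈ I, ∀ σ ∈ S ∪ {MulHom.id G}, p I (σ (s i)))
    (cons : ∀ I, ∀ i ∈ I, ∀ σ ∈ S ∪ {MulHom.id G}, ∀ w ∈ finiteProducts S s (I ∩ Set.Ioi i),
      p (I ∩ Set.Ioi i) w → p I (σ (s i) * w))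
    {I : Set ℕ} {w : G} (hw : w ∈ finiteProducts S s I) : p I w := by
  obtain ⟨k, i, σ, hi, hiI, hσ, rfl⟩ := hw
  induction k generalizing I with
  | zero => exact single I _ (hiI 0) _ (hσ 0)
  | succ k ih =>
    have hi' : StrictMono fun j : Fin (k + 1) => i j.succ :=
      fun _ _ h => hi (Fin.succ_lt_succ_iff.2 h)
    have hiI' : ∀ j : Fin (k + 1), i j.succ ∈ I ∩ Set.Ioi (i 0) :=
      fun j => ⟨hiI _, hi j.succ_pos⟩
    exact cons I _ (hiI 0) _ (hσ 0) _ ⟨k, _, _, hi', hiI', fun j => hσ j.succ, rfl⟩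
      (ih (fun j => i j.succ) (fun j => σ j.succ) hi' hiI' fun j => hσ j.succ)

theorem finiteProducts_mono {G : Type*} [Mul G] {S : Set (G →ₙ* G)} {s : ℕ → G} {I J : Set ℕ}
    (h : I ⊆ J) : finiteProducts S s I ⊆ finiteProducts S s J := by
  rintro _ ⟨k, i, σ, hi, hiI, hσ, rfl⟩
  exact ⟨k, i, σ, hi, fun j => h (hiI j), hσ, rfl⟩

theorem exists_mem_finiteProducts_inter_Iio {G : Type*} [Mul G] {S : Set (G →ₙ* G)} {s : ℕ → G}
    {I : Set ℕ} {w : G} (hw : w ∈ finiteProducts S s I) :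
    ∃ m, w ∈ finiteProducts S s (I ∩ Set.Iio m) := by
  obtain ⟨k, i, σ, hi, hiI, hσ, rfl⟩ := hw
  exact ⟨i (Fin.last k) + 1, k, i, σ, hi,
    fun j => ⟨hiI j, Nat.lt_succ_of_le (hi.monotone j.le_last)⟩, hσ, rfl⟩

theorem mul_mem_finiteProducts {G : Type*} [Semigroup G] {S : Set (G →ₙ* G)} {s : ℕ → G}
    {I J : Set ℕ} {w z : G} (hw : w ∈ finiteProducts S s I) (hz : z ∈ finiteProducts S s J)
    (hIJ : ∀ i ∈ I, ∀ j ∈ J, i < j) : w * z ∈ finiteProducts S s (I ∪ J) := by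
  refine finiteProducts_induction
    (p := fun I w => (∀ i ∈ I, ∀ j ∈ J, i < j) → w * z ∈ finiteProducts S s (I ∪ J))
    ?_ ?_ hw hIJ
  · intro I i hi σ hσ h
    have hJ : J ⊆ (I ∪ J) ∩ Set.Ioi i := fun j hj => ⟨Or.inr hj, h i hi j hj⟩
    exact mul_mem_finiteProducts_cons (Or.inl hi) hσ (finiteProducts_mono hJ hz)
  · intro I i hi σ hσ w _ ih h
    rw [mul_assoc]
    refine mul_mem_finiteProducts_cons (Or.inl hi) hσ
      (finiteProducts_mono ?_ (ih fun l hl => h l hl.1))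
    rintro j (hj | hj)
    exacts [⟨Or.inl hj.1, hj.2⟩, ⟨Or.inr hj, h i hi j hj⟩]

theorem map_mem_finiteProducts {G : Type*} [Semigroup G] {S : Set (G →ₙ* G)} {s : ℕ → G}
    (hS : ∀ σ ∈ S, ∀ τ ∈ S, σ.comp τ ∈ S) {σ : G →ₙ* G} (hσ : σ ∈ S)
    {I : Set ℕ} {w : G} (hw : w ∈ finiteProducts S s I) : σ w ∈ finiteProducts S s I := by
  have hcomp : ∀ τ ∈ S ∪ {MulHom.id G}, σ.comp τ ∈ S ∪ {MulHom.id G} := by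
    rintro τ (hτ | rfl)
    exacts [Or.inl (hS σ hσ τ hτ), Or.inl hσ]
  refine finiteProducts_induction (p := fun I w => σ w ∈ finiteProducts S s I) ?_ ?_ hw
  · exact fun I i hi τ hτ => mem_finiteProducts_singleton hi (hcomp τ hτ)
  · intro I i hi τ hτ w _ ih
    rw [map_mul]
    exact mul_mem_finiteProducts_cons hi (hcomp τ hτ) ih

/-! ### Ultrafilters on a semigroup with retractions -/

theorem ultrafilter_map_mul {G H : Type*} [Mul G] [Mul H] (σ : G →ₙ* H) (p q : Ultrafilter G) :
    (p * q).map σ = p.map σ * q.map σ := by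
  refine Ultrafilter.coe_inj.1 (Filter.ext' fun P => ?_)
  rw [Ultrafilter.eventually_mul]
  simp only [Ultrafilter.coe_map, eventually_map, Ultrafilter.eventually_mul, map_mul]

/-- The pair of ultrafilters behind the theorem: `u` lives on `D`, absorbs `v`, and is sent to `v`
by each `σ ∈ S`. If `S` is empty, there need not be an ultrafilter in `T` containing `Dᶜ`, and
`v = u` is taken. -/
theorem exists_ultrafilter_pair {G : Type*} [Semigroup G] {D : Set G}
    (hD : ∀ x y, x * y ∈ D ↔ x ∈ D ∨ y ∈ D) {S : Set (G →ₙ* G)}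
    (hSD : ∀ σ ∈ S, ∀ x, σ x ∉ D) (hfix : ∀ σ ∈ S, ∀ x ∉ D, σ x = x)
    {T : Set (Ultrafilter G)} (hT : IsClosed T) (hTmul : ∀ p ∈ T, ∀ q ∈ T, p * q ∈ T)
    (hTmap : ∀ σ ∈ S, ∀ p ∈ T, p.map σ ∈ T) (hne : ∃ p ∈ T, D ∈ p) :
    ∃ u ∈ T, ∃ v : Ultrafilter G, D ∈ u ∧ u * u = u ∧ v * v = v ∧ u * v = u ∧ v * u = u ∧
      ∀ σ ∈ S, u.map σ = v := by
  have hcont := Ultrafilter.continuous_mul_left (M := G)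
  have hDleft : ∀ p q : Ultrafilter G, D ∈ q → D ∈ p * q := fun p q hq =>
    (Ultrafilter.eventually_mul p q (· ∈ D)).2 <| Eventually.of_forall fun x =>
      mem_of_superset hq fun y hy => (hD x y).2 (Or.inr hy)
  have hDright : ∀ p q : Ultrafilter G, D ∈ p → D ∈ p * q := fun p q hp =>
    (Ultrafilter.eventually_mul p q (· ∈ D)).2 <| mem_of_superset hp fun x hx =>
      Eventually.of_forall fun y => (hD x y).2 (Or.inl hx)
  have hK : IsCompact (T ∩ {p | D ∈ p}) := (hT.inter (ultrafilter_isClosed_basic D)).isCompact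
  have hKmul : ∀ p ∈ T ∩ {p | D ∈ p}, ∀ q ∈ T ∩ {p | D ∈ p}, p * q ∈ T ∩ {p | D ∈ p} :=
    fun p hp q hq => ⟨hTmul p hp.1 q hq.1, hDleft p q hq.2⟩
  rcases S.eq_empty_or_nonempty with rfl | ⟨σ₀, hσ₀⟩
  · obtain ⟨u, hu, huu⟩ := exists_idempotent_in_compact_subsemigroup hcont _ hne hK hKmul
    exact ⟨u, hu.1, u, hu.2, huu, huu, huu, huu, by simp⟩
  have hmapD : ∀ σ ∈ S, ∀ p : Ultrafilter G, Dᶜ ∈ p.map σ := fun σ hσ p =>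
    Ultrafilter.mem_map.2 <| mem_of_superset univ_mem fun x _ => hSD σ hσ x
  obtain ⟨v, hv, hvv, hvmin⟩ := exists_minimal_idempotent hcont
    (N := T ∩ {p | Dᶜ ∈ p}) (by
      obtain ⟨p, hp, -⟩ := hne
      exact ⟨p.map σ₀, hTmap σ₀ hσ₀ p hp, hmapD σ₀ hσ₀ p⟩)
    (hT.inter (ultrafilter_isClosed_basic Dᶜ)).isCompact (fun p hp q hq => ⟨hTmul p hp.1 q hq.1,
      (Ultrafilter.eventually_mul p q (· ∈ Dᶜ)).2 <| mem_of_superset hp.2 fun x hx =>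
        mem_of_superset hq.2 fun y hy h => ((hD x y).1 h).elim hx hy⟩)
  obtain ⟨u, hu, huu, huv, hvu⟩ := exists_idempotent_le hcont hne hK hKmul hvv
    (fun p hp => ⟨hTmul v hv.1 p hp.1, hDleft v p hp.2⟩)
    (fun p hp => ⟨hTmul p hp.1 v hv.1, hDright p v hp.2⟩)
  refine ⟨u, hu.1, v, hu.2, huu, hvv, huv, hvu, fun σ hσ => ?_⟩
  have hσv : v.map σ = v := by
    have hid : σ =ᶠ[v] id := mem_of_superset hv.2 fun x hx => hfix σ hσ x hx
    exact Ultrafilter.coe_inj.1 ((Filter.map_congr hid).trans Filter.map_id)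
  refine hvmin _ ⟨hTmap σ hσ u hu.1, hmapD σ hσ u⟩ ?_ ?_ ?_
  · rw [← ultrafilter_map_mul, huu]
  · conv_lhs => rw [← hσv, ← ultrafilter_map_mul, huv]
  · conv_lhs => rw [← hσv, ← ultrafilter_map_mul, hvu]

/-! ### The recursive construction -/

/-- One step of the construction: for `P ∈ u` and `Q ∈ v`, almost every `a` has itself and its
images in the right set, and leaves a large set of continuations `P' ∈ u` and `Q' ∈ v`. -/
theorem exists_next_term {G : Type*} [Semigroup G] {S : Set (G →ₙ* G)} (hS : S.Finite)
    {u v : Ultrafilter G} (huu : u * u = u) (hvv : v * v = v) (huv : u * v = u) (hvu : v * u = u)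
    (hmap : ∀ σ ∈ S, u.map σ = v) {E P Q : Set G} (hE : E ∈ u) (hP : P ∈ u) (hQ : Q ∈ v) :
    ∃ a ∈ E, a ∈ P ∧ (∀ σ ∈ S, σ a ∈ Q) ∧ ∃ P' ∈ u, ∃ Q' ∈ v, P' ⊆ P ∧ Q' ⊆ Q ∧
      (∀ w ∈ P', a * w ∈ P ∧ ∀ σ ∈ S, σ a * w ∈ P) ∧
      (∀ w ∈ Q', a * w ∈ P ∧ ∀ σ ∈ S, σ a * w ∈ Q) := by
  have of_map : ∀ p : G → Prop, (∀ᶠ x in v, p x) → ∀ᶠ a in u, ∀ σ ∈ S, p (σ a) := by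
    intro p hp
    refine (eventually_all_finite hS).2 fun σ hσ => ?_
    rw [← hmap σ hσ] at hp
    exact hp
  have h₁ : ∀ᶠ a in u, ∀ᶠ w in u, a * w ∈ P :=
    (Ultrafilter.eventually_mul u u (· ∈ P)).1 (huu.symm ▸ hP)
  have h₂ : ∀ᶠ a in u, ∀ᶠ w in v, a * w ∈ P :=
    (Ultrafilter.eventually_mul u v (· ∈ P)).1 (huv.symm ▸ hP)
  have h₃ : ∀ᶠ a in u, ∀ σ ∈ S, ∀ᶠ w in u, σ a * w ∈ P :=
    of_map (fun x => ∀ᶠ w in u, x * w ∈ P)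
      ((Ultrafilter.eventually_mul v u (· ∈ P)).1 (hvu.symm ▸ hP))
  have h₄ : ∀ᶠ a in u, ∀ σ ∈ S, ∀ᶠ w in v, σ a * w ∈ Q :=
    of_map (fun x => ∀ᶠ w in v, x * w ∈ Q)
      ((Ultrafilter.eventually_mul v v (· ∈ Q)).1 (hvv.symm ▸ hQ))
  have h₅ : ∀ᶠ a in u, ∀ σ ∈ S, σ a ∈ Q := of_map (· ∈ Q) hQ
  have h₆ : ∀ᶠ a in u, a ∈ E := hE
  have h₇ : ∀ᶠ a in u, a ∈ P := hP
  obtain ⟨a, a₁, a₂, a₃, a₄, a₅, a₆, a₇⟩ :=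
    (h₁.and (h₂.and (h₃.and (h₄.and (h₅.and (h₆.and h₇)))))).exists
  exact ⟨a, a₆, a₇, a₅,
    _, Filter.inter_mem hP (a₁.and ((eventually_all_finite hS).2 a₃)),
    _, Filter.inter_mem hQ (a₂.and ((eventually_all_finite hS).2 a₄)),
    Set.inter_subset_left, Set.inter_subset_left, fun _ hw => hw.2, fun _ hw => hw.2⟩

/-- The conclusion of Carlson's theorem for a set `B` that belongs to an ultrafilter `u` as in
`exists_ultrafilter_pair`. -/
theorem exists_extracted_sequence {G : Type*} [Semigroup G] {D : Set G}
    (hD : ∀ x y, x * y ∈ D ↔ x ∈ D ∨ y ∈ D) {S : Set (G →ₙ* G)} (hS : S.Finite)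
    (hSD : ∀ σ ∈ S, ∀ x, σ x ∉ D) {s : ℕ → G} {u v : Ultrafilter G}
    (hu : ∀ m, finiteProducts S s (Set.Ici m) ∈ u) (hDu : D ∈ u)
    (huu : u * u = u) (hvv : v * v = v) (huv : u * v = u) (hvu : v * u = u)
    (hmap : ∀ σ ∈ S, u.map σ = v) {B : Set G} (hB : B ∈ u) :
    ∃ (n : ℕ → ℕ) (a : ℕ → G), StrictMono n ∧ (∀ i, 0 < n i) ∧
      (∀ i, a i ∈ finiteProducts S s (Set.Ico (n i) (n (i + 1))) ∩ D) ∧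
      finiteProducts S a Set.univ ∩ D ⊆ B := by
  -- A state of the recursion consists of a lower bound for the indices of `s` still available
  -- and of the sets to which the nonconstant and the constant products to come are confined.
  let State := {t : ℕ × Set G × Set G // t.2.1 ∈ u ∧ t.2.2 ∈ v}
  have step : ∀ t : State, ∃ (a : G) (t' : State), t.1.1 < t'.1.1 ∧
      a ∈ finiteProducts S s (Set.Ico t.1.1 t'.1.1) ∩ D ∧
      a ∈ t.1.2.1 ∧ (∀ σ ∈ S, σ a ∈ t.1.2.2) ∧ t'.1.2.1 ⊆ t.1.2.1 ∧ t'.1.2.2 ⊆ t.1.2.2 ∧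
      (∀ w ∈ t'.1.2.1, a * w ∈ t.1.2.1 ∧ ∀ σ ∈ S, σ a * w ∈ t.1.2.1) ∧
      (∀ w ∈ t'.1.2.2, a * w ∈ t.1.2.1 ∧ ∀ σ ∈ S, σ a * w ∈ t.1.2.2) := by
    rintro ⟨⟨m, P, Q⟩, hP, hQ⟩
    obtain ⟨a, ha, haP, haQ, P', hP', Q', hQ', h⟩ := exists_next_term hS huu hvv huv hvu hmap
      (Filter.inter_mem (hu m) hDu) hP hQ
    obtain ⟨l, hl⟩ := exists_mem_finiteProducts_inter_Iio ha.1
    have hsub : Set.Ici m ∩ Set.Iio l ⊆ Set.Ico m (max (m + 1) l) :=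
      fun i hi => ⟨hi.1, lt_max_of_lt_right hi.2⟩
    exact ⟨a, ⟨⟨max (m + 1) l, P', Q'⟩, hP', hQ'⟩, lt_max_of_lt_left m.lt_succ_self,
      ⟨finiteProducts_mono hsub hl, ha.2⟩, haP, haQ, h⟩
  choose f g hlt hf hfP hfQ hPsub hQsub hPmul hQmul using step
  let t : ℕ → State := fun i => Nat.rec ⟨⟨1, B, Set.univ⟩, hB, univ_mem⟩ (fun _ => g) i
  have hmono : StrictMono fun i => (t i).1.1 := strictMono_nat_of_lt_succ fun i => hlt (t i)
  have hPanti : Antitone fun i => (t i).1.2.1 := antitone_nat_of_succ_le fun i => hPsub (t i)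
  have hQanti : Antitone fun i => (t i).1.2.2 := antitone_nat_of_succ_le fun i => hQsub (t i)
  refine ⟨fun i => (t i).1.1, fun i => f (t i), hmono,
    fun i => Nat.one_pos.trans_le (hmono.monotone i.zero_le), fun i => hf (t i), ?_⟩
  rintro w ⟨hw, hwD⟩
  refine (finiteProducts_induction (p := fun I w => ∀ m, (∀ i ∈ I, m ≤ i) →
    (w ∈ D → w ∈ (t m).1.2.1) ∧ (w ∉ D → w ∈ (t m).1.2.2)) ?_ ?_ hw 0 fun i _ => i.zero_le).1 hwD
  · rintro I i hi σ (hσ | rfl) m hm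
    · exact ⟨fun h => (hSD σ hσ _ h).elim, fun _ => hQanti (hm i hi) (hfQ (t i) σ hσ)⟩
    · exact ⟨fun _ => hPanti (hm i hi) (hfP (t i)), fun h => (h (hf (t i)).2).elim⟩
  · rintro I i hi σ hσ w - ih m hm
    obtain ⟨ihP, ihQ⟩ := ih (i + 1) fun j hj => hj.2
    by_cases hw : w ∈ D
    · have key := hPmul (t i) w (ihP hw)
      refine ⟨fun _ => hPanti (hm i hi) ?_, fun h => (h ((hD _ _).2 (Or.inr hw))).elim⟩
      rcases hσ with hσ | rfl
      exacts [key.2 σ hσ, key.1]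
    · have key := hQmul (t i) w (ihQ hw)
      rcases hσ with hσ | rfl
      · exact ⟨fun h => (((hD _ _).1 h).elim (hSD σ hσ _) hw).elim,
          fun _ => hQanti (hm i hi) (key.2 σ hσ)⟩
      · exact ⟨fun _ => hPanti (hm i hi) key.1,
          fun h => (h ((hD _ _).2 (Or.inl (hf (t i)).2))).elim⟩

/-- Carlson's theorem for a finite set `S` of retractions of a semigroup onto the complement of an
ideal. -/
theorem exists_monochromatic_extracted_sequence {G : Type*} [Semigroup G] {D : Set G}
    (hD : ∀ x y, x * y ∈ D ↔ x ∈ D ∨ y ∈ D) {S : Set (G →ₙ* G)} (hS : S.Finite)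
    (hSD : ∀ σ ∈ S, ∀ x, σ x ∉ D) (hfix : ∀ σ ∈ S, ∀ x ∉ D, σ x = x)
    {s : ℕ → G} (hs : ∀ i, s i ∈ D) {R : Type*} [Finite R] (c : G → R) :
    ∃ (n : ℕ → ℕ) (a : ℕ → G), StrictMono n ∧ (∀ i, 0 < n i) ∧
      (∀ i, a i ∈ finiteProducts S s (Set.Ico (n i) (n (i + 1))) ∩ D) ∧
      ∃ color : R, ∀ w ∈ finiteProducts S a Set.univ ∩ D, c w = color := by
  have hcomp : ∀ σ ∈ S, ∀ τ ∈ S, σ.comp τ ∈ S := fun σ hσ τ hτ => by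
    have : σ.comp τ = τ := MulHom.ext fun x => hfix σ hσ _ (hSD τ hτ x)
    rwa [this]
  let T : Set (Ultrafilter G) := ⋂ m, {p | finiteProducts S s (Set.Ici m) ∈ p}
  have hT : IsClosed T := isClosed_iInter fun m => ultrafilter_isClosed_basic _
  have hTmul : ∀ p ∈ T, ∀ q ∈ T, p * q ∈ T := by
    refine fun p hp q hq => Set.mem_iInter.2 fun m => ?_
    refine (Ultrafilter.eventually_mul p q _).2 (mem_of_superset (Set.mem_iInter.1 hp m) ?_)
    intro x hx
    obtain ⟨l, hl⟩ := exists_mem_finiteProducts_inter_Iio hx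
    refine mem_of_superset (Set.mem_iInter.1 hq (max m l)) fun y hy => ?_
    refine finiteProducts_mono ?_
      (mul_mem_finiteProducts hl hy fun i hi j hj => hi.2.trans_le ((le_max_right m l).trans hj))
    rintro i (hi | hi)
    exacts [hi.1, (le_max_left m l).trans hi]
  have hTmap : ∀ σ ∈ S, ∀ p ∈ T, p.map σ ∈ T := fun σ hσ p hp => Set.mem_iInter.2 fun m => by
    have hm : finiteProducts S s (Set.Ici m) ∈ p := Set.mem_iInter.1 hp m
    have hsub : finiteProducts S s (Set.Ici m) ⊆ σ ⁻¹' finiteProducts S s (Set.Ici m) :=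
      fun _ hx => map_mem_finiteProducts hcomp hσ hx
    exact mem_of_superset hm hsub
  -- A nonprincipal ultrafilter on the indices yields an element of `T` containing `D`.
  have hne : ∃ p ∈ T, D ∈ p := by
    refine ⟨(hyperfilter ℕ).map s, Set.mem_iInter.2 fun m => ?_,
      Ultrafilter.mem_map.2 <| mem_of_superset univ_mem fun i _ => hs i⟩
    have hm : Set.Ici m ∈ hyperfilter ℕ := Nat.hyperfilter_le_atTop (mem_atTop m)
    have hsub : Set.Ici m ⊆ s ⁻¹' finiteProducts S s (Set.Ici m) := fun i hi =>
      mem_finiteProducts_singleton (σ := MulHom.id G) hi (Or.inr rfl)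
    exact mem_of_superset hm hsub
  obtain ⟨u, huT, v, hDu, huu, hvv, huv, hvu, hmap⟩ :=
    exists_ultrafilter_pair hD hSD hfix hT hTmul hTmap hne
  obtain ⟨color, hcolor⟩ := (u.map c).eq_pure_of_finite
  have hB : c ⁻¹' {color} ∈ u := by
    rw [← Ultrafilter.mem_map, hcolor]
    exact Set.mem_singleton color
  obtain ⟨n, a, hn, hpos, ha, hw⟩ := exists_extracted_sequence hD hS hSD
    (Set.mem_iInter.1 huT) hDu huu hvv huv hvu hmap hB
  exact ⟨n, a, hn, hpos, ha, color, fun w h => hw h⟩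

/-! ### Constant words -/

namespace WordsOver

/-- The homomorphism to the multiplicative semigroup `{0, 1} ⊆ ℕ` that takes the value `1` on the
constants and `0` at the variable, and so is the indicator function of the constant words. -/
def constIndicator (C : Type*) [Semigroup C] : WordsOver C →ₙ* ℕ :=
  SemigroupFreeProduct.lift ⟨fun _ => 1, fun _ _ => rfl⟩ ⟨fun _ => 0, fun _ _ => rfl⟩

theorem constIndicator_eq_one_iff {C : Type*} [Semigroup C] (w : WordsOver C) :
    constIndicator C w = 1 ↔ w ∈ constants C := by
  constructor
  · obtain ⟨w, rfl⟩ := SemigroupFreeProduct.mk_surjective w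
    induction w using FreeSemigroup.recOnMul with
    | ih1 l =>
      rcases l with a | b
      · exact fun _ => ⟨a, rfl⟩
      · intro h
        have h0 : constIndicator C (SemigroupFreeProduct.inr b) = 0 :=
          SemigroupFreeProduct.lift_inr _ _ b
        exact absurd (h0.symm.trans h) zero_ne_one
    | ih2 l w ihl ihw =>
      intro h
      rw [map_mul, map_mul, mul_eq_one] at h
      obtain ⟨a, ha⟩ := ihl h.1
      obtain ⟨b, hb⟩ := ihw h.2
      exact ⟨a * b, by rw [map_mul, map_mul, ha, hb]⟩
  · rintro ⟨a, rfl⟩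
    exact SemigroupFreeProduct.lift_inl _ _ a

theorem mul_mem_constants_iff {C : Type*} [Semigroup C] (w z : WordsOver C) :
    w * z ∈ constants C ↔ w ∈ constants C ∧ z ∈ constants C := by
  simp only [← constIndicator_eq_one_iff, map_mul, mul_eq_one]

theorem subst_mem_constants {C : Type*} [Semigroup C] (a : C) (w : WordsOver C) :
    subst a w ∈ constants C :=
  ⟨eval a w, rfl⟩

theorem subst_of_mem_constants {C : Type*} [Semigroup C] (a : C) {w : WordsOver C}
    (hw : w ∈ constants C) : subst a w = w := by
  obtain ⟨b, rfl⟩ := hw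
  exact congrArg (const C) (SemigroupFreeProduct.lift_inl _ _ b)

end WordsOver

/-! ### Carlson's theorem -/

theorem mainTheorem5 {C : Type*} [Semigroup C] (A : Set C) (hA : A.Finite)
    (hgen : Subsemigroup.closure A = ⊤)
    (s : ℕ → WordsOver C) (hs : ∀ i, s i ∉ WordsOver.constants C)
    (r : ℕ) (c : WordsOver C → Fin r) :
    ∃ (n : ℕ → ℕ) (a : ℕ → WordsOver C),
      StrictMono n ∧ (∀ i, 0 < n i) ∧
      (∀ i, a i ∈ finiteProducts (WordsOver.subst '' A) s (Set.Ico (n i) (n (i + 1))) \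
        WordsOver.constants C) ∧
      ∃ color : Fin r, ∀ w ∈ finiteProducts (WordsOver.subst '' A) a Set.univ \
        WordsOver.constants C, c w = color := by
  refine exists_monochromatic_extracted_sequence (D := (WordsOver.constants C)ᶜ) ?_
    (hA.image _) ?_ ?_ hs c
  · intro w z
    rw [Set.mem_compl_iff, WordsOver.mul_mem_constants_iff, not_and_or]
    rfl
  · rintro _ ⟨a, -, rfl⟩ w h
    exact h (WordsOver.subst_mem_constants a w)
  · rintro _ ⟨a, -, rfl⟩ w h
    exact WordsOver.subst_of_mem_constants a (not_not.1 h)
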